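/- For a set $S$ of cardinality $\omega_1$, let $\lambda_{\omega_1}$ be the standard product probability measure on $2^{\omega_1}=\{0,1\}^{S}$ (each factor $\{0,1\}$ carrying the measure that gives mass $1/2$ to each point), let $\mathcal N_{\omega_1}$ be the ideal of $\lambda_{\omega_1}$-null subsets of $2^{\omega_1}$, and let $\mathrm{cov}(\mathcal N_{\omega_1})$ be the least cardinality of a family $\mathcal A\subseteq\mathcal N_{\omega_1}$ with $\bigcup\mathcal A=2^{\omega_1}$. Assume $\mathrm{cov}(\mathcal N_{\omega_1})>\omega_1$. Let $K$ be a compact Hausdorff space such that - $K$ is countably tight: whenever $x\in\overline{A}$ for some $A\subseteq K$, there is a countable $B\subseteq A$ with $x\in\overline{B}$; and - $K$ supports a measure: there is a finite Borel measure $\mu$ on $K$ which is Radon (inner regular with respect to compact sets) and satisfies $\mu(U)>0$ for every nonempty open $U\subseteq K$. Then $K$ has a countable $\pi$-base: there is a countable family $\mathcal P$ of nonempty open subsets of $K$ such that every nonempty open $V\subseteq K$ contains some $U\in\mathcal P$. -/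

import Mathlib

open MeasureTheory Cardinal

universe u

namespace SmallCompacta

/-- The ideal `𝒩_μ` of `μ`-null sets. In Mathlib `μ A` is the outer measure of an arbitrary set `A`,
so `A` is in the ideal iff it is contained in a measurable set of measure zero. -/
def nullIdeal {X : Type u} [MeasurableSpace X] (μ : Measure X) : Order.Ideal (Set X) where
  carrier := {A | μ A = 0}
  lower' := fun _ _ hBA hA => measure_mono_null hBA hA
  nonempty' := ⟨∅, measure_empty⟩
  directed' := fun A hA B hB =>
    ⟨A ∪ B, measure_union_null hA hB, Set.subset_union_left, Set.subset_union_right⟩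

/-- `cov(𝓘)`: the smallest cardinality of a subfamily of the ideal `𝓘` that covers `X`. -/
noncomputable def cov {X : Type u} (I : Order.Ideal (Set X)) : Cardinal.{u} :=
  sInf {c | ∃ 𝒜 : Set (Set X), (∀ A ∈ 𝒜, A ∈ I) ∧ ⋃₀ 𝒜 = Set.univ ∧ #𝒜 = c}

/-- The cube `2^κ`, as the set of functions from a set of cardinality `κ` to `{0, 1}`. -/
abbrev Cube (κ : Cardinal.{u}) : Type u := κ.out → Bool

/-- The standard product measure `λ_κ` on `2^κ`, the power of the measure on `{0, 1}` that gives
each point the mass `1/2`. It is given on the product σ-algebra; the Borel sets of `2^κ` lie in its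
completion, so it has the same null sets as its extension to the Borel sets. -/
noncomputable def cubeMeasure (κ : Cardinal.{u}) : Measure (Cube κ) :=
  Measure.infinitePi fun _ : κ.out => (PMF.uniformOfFintype Bool).toMeasure

/-- The ideal `𝒩_κ` of `λ_κ`-null subsets of `2^κ`. -/
noncomputable def cubeNullIdeal (κ : Cardinal.{u}) : Order.Ideal (Set (Cube κ)) :=
  nullIdeal (cubeMeasure κ)

/-- Countable tightness: a point in the closure of a set is in the closure of a countable subset. -/
def CountablyTight (K : Type u) [TopologicalSpace K] : Prop :=
  ∀ (A : Set K) (x : K), x ∈ closure A → ∃ B : Set K, B ⊆ A ∧ B.Countable ∧ x ∈ closure B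

/-- `K` supports a measure: there is a finite Borel measure on `K`, inner regular with respect to
compact sets (Radon), which is positive on every nonempty open set. -/
def SupportsMeasure (K : Type u) [TopologicalSpace K] [MeasurableSpace K] [BorelSpace K] : Prop :=
  ∃ μ : Measure K, IsFiniteMeasure μ ∧ μ.InnerRegular ∧
    ∀ U : Set K, IsOpen U → U.Nonempty → 0 < μ U

/-- `P` is a π-base of `K`: a family of nonempty open sets such that every nonempty open set
contains a member of the family. -/
def IsPiBase {K : Type u} [TopologicalSpace K] (P : Set (Set K)) : Prop :=
  (∀ U ∈ P, IsOpen U ∧ U.Nonempty) ∧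
    ∀ V : Set K, IsOpen V → V.Nonempty → ∃ U ∈ P, U ⊆ V

end SmallCompacta

/-! Suppose there is no countable π-base. A recursion of length `ω₁` (`exists_zeroSet_sequence`)
yields disjoint pairs of zero sets `F i`, `H i`, with `F i` of nonempty interior and `H i` meeting
every nonempty finite intersection of earlier sets. Along an uncountable centered subfamily of the
`F i`, these pairs form a free sequence, which countable tightness forbids
(`CountablyTight.countable_of_free`).

The centered subfamily comes from the measure (`exists_uncountable_centered`). The indicators of the
`F i` push a conditioned measure to a law on `2^ω₁`. Being centered and being unbounded in `ω₁` are
expressed by avoiding `ω₁` null sets of this law. Such a point exists because every law on `2^ω₁` is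
an image of the fair-coin measure (`exists_measurePreserving_cubeMeasure`), so null sets pull back
to null sets of the cube. -/

namespace SmallCompacta

/-! ### Free sequences and countable π-bases. -/

section FreeSequence

variable {ι : Type*} [LinearOrder ι]

/-- If all proper initial segments are countable, a countable set does not bound an uncountable
one. -/
theorem exists_mem_forall_lt (hι : ∀ i : ι, (Set.Iio i).Countable) {S C : Set ι}
    (hS : ¬ S.Countable) (hC : C.Countable) : ∃ i ∈ S, ∀ c ∈ C, c < i := by
  by_contra! h
  refine hS ((hC.biUnion fun c _ => ((hι c).insert c)).mono fun i hi => ?_)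
  obtain ⟨c, hc, hic⟩ := h i hi
  simp only [Set.mem_iUnion, Set.mem_insert_iff, Set.mem_Iio]
  exact ⟨c, hc, hic.eq_or_lt⟩

variable {K : Type*} [TopologicalSpace K]

/-- One step of the construction: in a compact Hausdorff space without a countable π-base, for
countably many zero sets there is a pair of disjoint zero sets, the first with nonempty interior,
such that the second meets all of the given ones. -/
theorem exists_zeroSet_pair [CompactSpace K] [T2Space K]
    (hK : ¬ ∃ P : Set (Set K), P.Countable ∧ IsPiBase P) {G : Set C(K, ℝ)} (hG : G.Countable) :
    ∃ p : C(K, ℝ) × C(K, ℝ), 0 ≤ p.1 ∧ 0 ≤ p.2 ∧ (interior {x | p.1 x = 0}).Nonempty ∧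
      (∀ x, p.1 x = 0 → p.2 x ≠ 0) ∧
      ∀ g ∈ G, 0 ≤ g → (∃ x, g x = 0) → ∃ x, g x = 0 ∧ p.2 x = 0 := by
  -- By compactness these sublevel sets shrink to the zero set of `g`. An open `V` containing none
  -- of them therefore contains no nonempty zero set from `G`.
  let P : Set (Set K) :=
    (fun q : C(K, ℝ) × ℕ => {x | q.1 x < 1 / ((q.2 : ℝ) + 1)}) ''
      ({g ∈ G | ∃ x, g x = 0} ×ˢ Set.univ)
  have hPc : P.Countable :=
    ((hG.mono (Set.sep_subset _ _)).prod Set.countable_univ).image _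
  have hPo : ∀ U ∈ P, IsOpen U ∧ U.Nonempty := by
    rintro _ ⟨⟨g, n⟩, ⟨⟨-, x, hx⟩, -⟩, rfl⟩
    refine ⟨isOpen_lt (map_continuous g) continuous_const, x, ?_⟩
    simp only [Set.mem_ofPred_eq, hx]
    positivity
  have hP : ∃ V : Set K, IsOpen V ∧ V.Nonempty ∧ ∀ U ∈ P, ¬ U ⊆ V := by
    by_contra! h
    exact hK ⟨P, hPc, hPo, h⟩
  obtain ⟨V, hVo, ⟨v, hv⟩, hV⟩ := hP
  obtain ⟨h, h0, h1, -⟩ := exists_continuous_zero_one_of_isClosed hVo.isClosed_compl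
    (isClosed_singleton (x := v)) (Set.disjoint_singleton_right.2 fun hv' => hv' hv)
  have hv1 : h v = 1 := h1 rfl
  -- The zero sets are `h ≥ 2/3` and `h ≤ 1/3`; the latter contains the complement of `V`.
  refine ⟨⟨⟨fun x => max 0 (2 / 3 - h x), by fun_prop⟩, ⟨fun x => max 0 (h x - 1 / 3),
    by fun_prop⟩⟩, fun x => le_max_left _ _, fun x => le_max_left _ _, ⟨v, ?_⟩, ?_, ?_⟩
  · refine mem_interior.2 ⟨{x | 2 / 3 < h x}, fun x hx => ?_,
      isOpen_lt continuous_const (map_continuous h), ?_⟩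
    · simp only [Set.mem_ofPred_eq] at hx
      simp [hx.le]
    · simp [hv1]; norm_num
  · intro x hx hx'
    simp only [ContinuousMap.coe_mk, sup_eq_left] at hx hx'
    linarith
  · intro g hg hg0 hgx
    by_contra! hne
    have hsub : ∀ x, g x = 0 → x ∈ V := by
      intro x hx
      by_contra hxV
      have : h x = 0 := h0 hxV
      exact hne x hx (by simp [this])
    obtain ⟨n, hn⟩ : ∃ n : ℕ, ∀ x ∈ Vᶜ, 1 / ((n : ℝ) + 1) ≤ g x := by
      rcases Set.eq_empty_or_nonempty Vᶜ with hE | hE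
      · exact ⟨0, fun x hx => by simp [hE] at hx⟩
      · obtain ⟨y, hy, hmin⟩ := hVo.isClosed_compl.isCompact.exists_isMinOn hE
          (map_continuous g).continuousOn
        have hpos : 0 < g y := lt_of_le_of_ne (hg0 y) fun h' => hy (hsub y h'.symm)
        obtain ⟨n, hn⟩ := exists_nat_one_div_lt hpos
        exact ⟨n, fun x hx => hn.le.trans (hmin hx)⟩
    refine hV _ ⟨(g, n), ⟨⟨hg, hgx⟩, trivial⟩, rfl⟩ fun x hx => ?_
    by_contra hxV
    exact (hn x hxV).not_gt hx

/-- The recursion of length `ι`: a sequence of pairs of disjoint zero sets such that nonempty finite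
intersections of previous ones meet the second member of each pair. -/
theorem exists_zeroSet_sequence [WellFoundedLT ι] (hι : ∀ i : ι, (Set.Iio i).Countable)
    [CompactSpace K] [T2Space K]
    (hK : ¬ ∃ P : Set (Set K), P.Countable ∧ IsPiBase P) :
    ∃ f k : ι → C(K, ℝ),
      (∀ i, (interior {x | f i x = 0}).Nonempty) ∧ (∀ i x, f i x = 0 → k i x ≠ 0) ∧
      ∀ (i : ι) (s t : Finset ι), (∀ j ∈ s, j < i) → (∀ j ∈ t, j < i) →
        (∃ x, (∀ j ∈ s, f j x = 0) ∧ ∀ j ∈ t, k j x = 0) →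
        ∃ x, (∀ j ∈ s, f j x = 0) ∧ (∀ j ∈ t, k j x = 0) ∧ k i x = 0 := by
  classical
  have step : ∀ G : Set C(K, ℝ), ∃ p : C(K, ℝ) × C(K, ℝ), G.Countable →
      0 ≤ p.1 ∧ 0 ≤ p.2 ∧ (interior {x | p.1 x = 0}).Nonempty ∧
      (∀ x, p.1 x = 0 → p.2 x ≠ 0) ∧
      ∀ g ∈ G, 0 ≤ g → (∃ x, g x = 0) → ∃ x, g x = 0 ∧ p.2 x = 0 := by
    intro G
    by_cases hG : G.Countable
    · obtain ⟨p, hp⟩ := exists_zeroSet_pair hK hG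
      exact ⟨p, fun _ => hp⟩
    · exact ⟨0, fun h => absurd h hG⟩
  choose next hnext using step
  -- A sum of nonnegative functions vanishes exactly on the intersection of their zero sets, so
  -- `gen` encodes all finite intersections of earlier sets.
  let gen : ∀ i : ι, (∀ j, j < i → C(K, ℝ) × C(K, ℝ)) → Set C(K, ℝ) := fun i r =>
    Set.range fun q : Finset (Set.Iio i) × Finset (Set.Iio i) =>
      ∑ j ∈ q.1, (r j j.2).1 + ∑ j ∈ q.2, (r j j.2).2
  let Φ : ι → C(K, ℝ) × C(K, ℝ) := wellFounded_lt.fix fun i r => next (gen i r)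
  have hΦ : ∀ i, Φ i = next (gen i fun j _ => Φ j) := fun i => wellFounded_lt.fix_eq _ i
  have hcount : ∀ i, (gen i fun j _ => Φ j).Countable := fun i => by
    have := (hι i).to_subtype
    exact Set.countable_range _
  have key := fun i => hnext _ (hcount i)
  simp only [← hΦ] at key
  have hf0 : ∀ i x, 0 ≤ (Φ i).1 x := fun i x => (key i).1 x
  have hk0 : ∀ i x, 0 ≤ (Φ i).2 x := fun i x => (key i).2.1 x
  refine ⟨fun i => (Φ i).1, fun i => (Φ i).2,
    fun i => (key i).2.2.1, fun i => (key i).2.2.2.1, ?_⟩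
  rintro i s t hs ht ⟨x, hxs, hxt⟩
  let g : C(K, ℝ) := ∑ j ∈ s, (Φ j).1 + ∑ j ∈ t, (Φ j).2
  have hg : g ∈ gen i fun j _ => Φ j := by
    refine ⟨(s.subtype (· ∈ Set.Iio i), t.subtype (· ∈ Set.Iio i)), ?_⟩
    exact congrArg₂ (· + ·) (Finset.sum_subtype_of_mem (fun j => (Φ j).1) hs)
      (Finset.sum_subtype_of_mem (fun j => (Φ j).2) ht)
  have hgx : ∀ y, g y = ∑ j ∈ s, (Φ j).1 y + ∑ j ∈ t, (Φ j).2 y := fun y => by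
    simp [g, ContinuousMap.sum_apply]
  have hs0 : ∀ y, 0 ≤ ∑ j ∈ s, (Φ j).1 y := fun y => Finset.sum_nonneg fun j _ => hf0 j y
  have ht0 : ∀ y, 0 ≤ ∑ j ∈ t, (Φ j).2 y := fun y => Finset.sum_nonneg fun j _ => hk0 j y
  obtain ⟨y, hy, hyk⟩ := (key i).2.2.2.2 g hg
    (fun y => (add_nonneg (hs0 y) (ht0 y)).trans_eq (hgx y).symm)
    ⟨x, by rw [hgx, Finset.sum_eq_zero hxs, Finset.sum_eq_zero hxt, add_zero]⟩
  rw [hgx, add_eq_zero_iff_of_nonneg (hs0 y) (ht0 y),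
    Finset.sum_eq_zero_iff_of_nonneg fun j _ => hf0 j y,
    Finset.sum_eq_zero_iff_of_nonneg fun j _ => hk0 j y] at hy
  exact ⟨y, hy.1, hy.2, hyk⟩

/-- A countably tight compact space has no uncountable free sequence. -/
theorem CountablyTight.countable_of_free {K : Type u} [TopologicalSpace K] [CompactSpace K]
    (hK : CountablyTight K) (hι : ∀ i : ι, (Set.Iio i).Countable) {f k : ι → C(K, ℝ)}
    (hfk : ∀ i x, f i x = 0 → k i x ≠ 0) {S : Set ι}
    (hS : ∀ s t : Finset ι, ↑s ⊆ S → ↑t ⊆ S → (∀ i ∈ s, ∀ j ∈ t, i < j) →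
      ∃ x, (∀ i ∈ s, f i x = 0) ∧ ∀ j ∈ t, k j x = 0) : S.Countable := by
  classical
  by_contra hSc
  have hfc : ∀ i, IsClosed {x | f i x = 0} := fun i =>
    isClosed_eq (map_continuous _) continuous_const
  have hkc : ∀ i, IsClosed {x | k i x = 0} := fun i =>
    isClosed_eq (map_continuous _) continuous_const
  -- Compactness turns the finite condition into a point for each cut of `S` at `i`.
  have hpt : ∀ i : ι, ∃ x, ∀ j ∈ S, (j < i → f j x = 0) ∧ (i ≤ j → k j x = 0) := by
    intro i
    let Z : S → Set K := fun j => if j < i then {x | f j x = 0} else {x | k j x = 0}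
    have hZ : (⋂ j, Z j).Nonempty := by
      refine CompactSpace.iInter_nonempty (fun j => ?_) fun t => ?_
      · dsimp only [Z]
        split_ifs
        exacts [hfc _, hkc _]
      · obtain ⟨x, hx1, hx2⟩ := hS ((t.image (↑)).filter (· < i)) ((t.image (↑)).filter (i ≤ ·))
          (by intro j; simp; tauto) (by intro j; simp; tauto)
          (fun a ha b hb => (Finset.mem_filter.1 ha).2.trans_le (Finset.mem_filter.1 hb).2)
        refine ⟨x, Set.mem_iInter₂.2 fun j hj => ?_⟩
        dsimp only [Z]
        split_ifs with hji
        · exact hx1 j (by simp [hj, hji])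
        · exact hx2 j (by simp [hj, not_lt.1 hji])
    obtain ⟨x, hx⟩ := hZ
    refine ⟨x, fun j hj => ?_⟩
    have := Set.mem_iInter.1 hx ⟨j, hj⟩
    constructor
    · intro h; simpa [Z, h] using this
    · intro h; simpa [Z, h.not_gt] using this
  choose x hx using hpt
  have htail : (⋂ i : S, closure (x '' {j ∈ S | i.1 < j})).Nonempty := by
    have : Nonempty S := by
      by_contra h
      rw [Set.nonempty_coe_sort, Set.not_nonempty_iff_eq_empty] at h
      exact hSc (h ▸ Set.countable_empty)
    refine IsCompact.nonempty_iInter_of_directed_nonempty_isCompact_isClosed _ ?_ (fun i => ?_)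
      (fun i => isClosed_closure.isCompact) fun i => isClosed_closure
    · refine directed_of_isDirected_le fun i j hij => closure_mono (Set.image_mono ?_)
      exact fun a ha => ⟨ha.1, lt_of_le_of_lt hij ha.2⟩
    · obtain ⟨j, hj, hij⟩ := exists_mem_forall_lt hι hSc (Set.countable_singleton i.1)
      exact ⟨x j, subset_closure ⟨j, ⟨hj, hij _ rfl⟩, rfl⟩⟩
  obtain ⟨z, hz⟩ := htail
  rw [Set.mem_iInter] at hz
  obtain ⟨i₀, hi₀, -⟩ := exists_mem_forall_lt hι hSc Set.countable_empty
  have hzS : z ∈ closure (x '' S) :=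
    closure_mono (Set.image_mono fun a ha => ha.1) (hz ⟨i₀, hi₀⟩)
  obtain ⟨B, hBS, hBc, hzB⟩ := hK _ _ hzS
  have : Nonempty ι := ⟨i₀⟩
  replace hBS : ∀ b ∈ B, ∃ i, i ∈ S ∧ x i = b := hBS
  choose! c hcS hc using hBS
  -- The index `i` lies beyond the countable set that captures `z`, so `k i z = 0`; but `z` is also
  -- in the closure of the tail after `i`, so `f i z = 0`.
  obtain ⟨i, hi, hCi⟩ := exists_mem_forall_lt hι hSc (hBc.image c)
  have h1 : k i z = 0 := by
    refine closure_minimal ?_ (hkc i) hzB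
    intro b hb
    rw [← hc b hb]
    exact (hx (c b) i hi).2 (hCi _ ⟨b, hb, rfl⟩).le
  have h2 : f i z = 0 := by
    refine closure_minimal ?_ (hfc i) (hz ⟨i, hi⟩)
    rintro _ ⟨c, hc, rfl⟩
    exact (hx c i hi).1 hc.2
  exact hfk i z h2 h1

/-- A countably tight compact space has a countable π-base if every family of closed sets with
nonempty interior, indexed by a suitable well-order, has an uncountable centered subfamily. -/
theorem CountablyTight.exists_countable_piBase {K : Type u} [TopologicalSpace K] [CompactSpace K]
    [T2Space K] [WellFoundedLT ι] (hK : CountablyTight K) (hι : ∀ i : ι, (Set.Iio i).Countable)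
    (hF : ∀ F : ι → Set K, (∀ i, IsClosed (F i)) → (∀ i, (interior (F i)).Nonempty) →
      ∃ S : Set ι, ¬ S.Countable ∧
        ∀ s : Finset ι, ↑s ⊆ S → (⋂ i ∈ s, F i).Nonempty) :
    ∃ P : Set (Set K), P.Countable ∧ IsPiBase P := by
  classical
  by_contra hP
  obtain ⟨f, k, hfi, hfk, hstep⟩ := exists_zeroSet_sequence hι hP
  obtain ⟨S, hS, hcent⟩ := hF (fun i => {x | f i x = 0})
    (fun i => isClosed_eq (map_continuous _) continuous_const) hfi
  refine hS (hK.countable_of_free hι hfk fun s t hs ht => ?_)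
  clear ht
  -- The largest element of `t` lies above `s` and the rest of `t`, so `hstep` adds it.
  induction t using Finset.induction_on_max with
  | empty =>
    intro _
    obtain ⟨x, hx⟩ := hcent s hs
    exact ⟨x, by simpa using hx, by simp⟩
  | insert a t hat ih =>
    intro hst
    obtain ⟨x, hx1, hx2, hx3⟩ := hstep a s t (fun i hi => hst i hi a (by simp)) hat
      (ih fun i hi j hj => hst i hi j (by simp [hj]))
    exact ⟨x, hx1, fun j hj => by
      rcases Finset.mem_insert.1 hj with rfl | hj
      exacts [hx3, hx2 j hj]⟩

end FreeSequence

open ProbabilityTheory Set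
open scoped ENNReal

/-! ### Sampling an arbitrary law on a power of `Bool` from independent uniform variables. -/

section Sampling

theorem measurableSet_forall_mem_eq {α : Type*} {C : Set α} (hC : C.Countable) (b : Bool) :
    MeasurableSet {y : α → Bool | ∀ i ∈ C, y i = b} := by
  have : {y : α → Bool | ∀ i ∈ C, y i = b} = ⋂ i ∈ C, (fun y : α → Bool => y i) ⁻¹' {b} := by
    ext; simp
  rw [this]
  exact MeasurableSet.biInter hC fun i _ => measurable_pi_apply i (measurableSet_singleton b)

/-- A probability measure on `α → Bool` is determined by the sets `{y | ∀ i ∈ s, y i = true}`. -/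
theorem ext_of_finset_true {α : Type*} {μ ν : Measure (α → Bool)} [IsProbabilityMeasure μ]
    [IsProbabilityMeasure ν]
    (h : ∀ s : Finset α, μ {y | ∀ i ∈ s, y i = true} = ν {y | ∀ i ∈ s, y i = true}) : μ = ν := by
  classical
  refine ext_of_generate_finite (range fun s : Finset α => {y : α → Bool | ∀ i ∈ s, y i = true})
    (le_antisymm ?_ ?_) ?_ ?_ (by simp)
  · refine iSup_le fun i => ?_
    rw [← measurable_iff_comap_le]
    refine @measurable_to_bool _ (MeasurableSpace.generateFrom _) _ ?_
    exact MeasurableSpace.measurableSet_generateFrom ⟨{i}, by ext; simp⟩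
  · refine MeasurableSpace.generateFrom_le ?_
    rintro _ ⟨s, rfl⟩
    exact measurableSet_forall_mem_eq (Finset.countable_toSet _) true
  · rintro _ ⟨s, rfl⟩ _ ⟨t, rfl⟩ -
    refine ⟨s ∪ t, ?_⟩
    ext y
    simp only [Finset.mem_union, mem_ofPred_eq, mem_inter_iff]
    grind
  · rintro _ ⟨s, rfl⟩
    exact h s

/-- Functions of disjoint sets of coordinates are independent for a product measure. -/
theorem indepFun_infinitePi_of_disjoint {κ E β γ : Type*} [MeasurableSpace E] [MeasurableSpace β]
    [MeasurableSpace γ] (c : Measure E) [IsProbabilityMeasure c] {S T : Set κ} (hST : Disjoint S T)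
    {X : (κ → E) → β} {Y : (κ → E) → γ}
    (hX : Measurable[⨆ i ∈ S, MeasurableSpace.comap (fun ω : κ → E => ω i) inferInstance] X)
    (hY : Measurable[⨆ i ∈ T, MeasurableSpace.comap (fun ω : κ → E => ω i) inferInstance] Y) :
    IndepFun X Y (Measure.infinitePi fun _ : κ => c) := by
  have h : iIndepFun (fun (i : κ) (ω : κ → E) => ω i) (Measure.infinitePi fun _ : κ => c) :=
    iIndepFun_infinitePi (X := fun _ x => x) fun _ => measurable_id
  have h' := indep_iSup_of_disjoint (fun i => (measurable_pi_apply i).comap_le) h.iIndep hST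
  rw [IndepFun_iff_Indep]
  exact indep_of_indep_of_le_left (indep_of_indep_of_le_right h' hY.comap_le) hX.comap_le

/-- The σ-algebra on `Ω` is left free so that it can be the one generated by the coordinates up to a
given index. -/
theorem measurable_decide_lt_comp {Ω α : Type*} [MeasurableSpace Ω] {X : Ω → α → Bool}
    (hX : ∀ a, Measurable fun ω => X ω a) {g : (α → Bool) → ℝ≥0∞} (hg : Measurable g) {u : Ω → ℝ≥0∞}
    (hu : Measurable u) : Measurable fun ω => decide (u ω < g (X ω)) := by
  refine measurable_to_bool ?_
  convert! measurableSet_lt hu (hg.comp (measurable_pi_iff.2 hX)) using 1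
  ext; simp

/-- Every probability measure on a power of `Bool` with well-ordered exponent is the image of a
product of uniform measures: the coordinates are drawn successively, each with its
conditional probability given the previous ones. -/
theorem exists_measurePreserving_infinitePi {ι : Type*} [LinearOrder ι] [WellFoundedLT ι]
    (ρ : Measure ℝ≥0∞) [IsProbabilityMeasure ρ] (hρ : ∀ p ≤ 1, ρ (Iio p) = p)
    (ν : Measure (ι → Bool)) [IsProbabilityMeasure ν] :
    ∃ f : (ι → ℝ≥0∞) → ι → Bool, MeasurePreserving f (Measure.infinitePi fun _ => ρ) ν := by
  classical
  let P : Measure (ι → ℝ≥0∞) := Measure.infinitePi fun _ => ρ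
  let res (i : ι) (y : ι → Bool) (j : Iio i) : Bool := y j
  have hres : ∀ i, Measurable (res i) := fun i => measurable_pi_iff.2 fun j => measurable_pi_apply _
  let ν₁ (i : ι) : Measure (Iio i → Bool) := (ν.restrict {y | y i = true}).map (res i)
  -- This density is the conditional probability that `y i = true` given the earlier coordinates.
  let g (i : ι) : (Iio i → Bool) → ℝ≥0∞ := (ν₁ i).rnDeriv (ν.map (res i))
  have hg : ∀ i, Measurable (g i) := fun i => Measure.measurable_rnDeriv _ _
  have hle : ∀ i, ν₁ i ≤ ν.map (res i) := fun i =>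
    Measure.map_mono Measure.restrict_le_self (hres i)
  have hprob : ∀ i, IsProbabilityMeasure (ν.map (res i)) := fun i =>
    Measure.isProbabilityMeasure_map (hres i).aemeasurable
  let f (ω : ι → ℝ≥0∞) : ι → Bool := wellFounded_lt.fix fun i r =>
    decide (ω i < g i fun j => r j j.2)
  have hf : ∀ ω i, f ω i = decide (ω i < g i fun j => f ω j) := fun ω i =>
    wellFounded_lt.fix_eq _ i
  let m (i : ι) : MeasurableSpace (ι → ℝ≥0∞) :=
    MeasurableSpace.comap (fun ω : ι → ℝ≥0∞ => ω i) inferInstance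
  have hm : ∀ (S : Set ι), ∀ i ∈ S, Measurable[⨆ i ∈ S, m i] fun ω : ι → ℝ≥0∞ => ω i :=
    fun S i hi => Measurable.mono (comap_measurable _) (le_iSup₂_of_le i hi le_rfl) le_rfl
  -- The value `f ω i` depends only on coordinates up to `i`, so the earlier values are independent
  -- of `ω i`.
  have hfm : ∀ i, Measurable[⨆ j ∈ Iic i, m j] fun ω => f ω i := by
    intro i
    induction i using WellFoundedLT.induction with
    | _ i ih =>
      simp only [hf _ i]
      refine @measurable_decide_lt_comp _ _ (⨆ j ∈ Iic i, m j) (fun ω (j : Iio i) => f ω j)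
        (fun j => ?_) _ (hg i) _ (hm _ i le_rfl)
      exact (ih j j.2).mono (biSup_mono fun k (hk : k ≤ j) => hk.trans (le_of_lt j.2)) le_rfl
  have hfm' : Measurable f := measurable_pi_iff.2 fun i =>
    (hfm i).mono (iSup₂_le fun j _ => (measurable_pi_apply j).comap_le) le_rfl
  have hXm : ∀ i, Measurable fun ω => res i (f ω) := fun i => (hres i).comp hfm'
  have hind : ∀ i, IndepFun (fun ω => res i (f ω)) (fun ω : ι → ℝ≥0∞ => ω i) P := by
    intro i
    refine indepFun_infinitePi_of_disjoint (S := Iio i) (T := {i}) ρ (by simp) ?_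
      (hm {i} i rfl)
    refine @measurable_pi_lambda _ _ _ (⨆ j ∈ Iio i, m j) _ _ fun j => ?_
    exact (hfm j).mono (biSup_mono fun k (hk : k ≤ j) => lt_of_le_of_lt hk j.2) le_rfl
  -- By independence and Fubini, the left side is the integral over `A` of `ρ (Iio (g i x))`, which
  -- equals `g i x` because `g i ≤ 1` almost everywhere.
  have hstep : ∀ i, P.map (fun ω => res i (f ω)) = ν.map (res i) →
      ∀ A : Set (Iio i → Bool), MeasurableSet A →
        P {ω | res i (f ω) ∈ A ∧ f ω i = true} = ν {y | res i y ∈ A ∧ y i = true} := by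
    intro i hi A hA
    have hB : MeasurableSet {q : (Iio i → Bool) × ℝ≥0∞ | q.1 ∈ A ∧ q.2 < g i q.1} :=
      (measurable_fst hA).inter (measurableSet_lt measurable_snd ((hg i).comp measurable_fst))
    have h1 : {ω | res i (f ω) ∈ A ∧ f ω i = true} = (fun ω => (res i (f ω), ω i)) ⁻¹'
        {q : (Iio i → Bool) × ℝ≥0∞ | q.1 ∈ A ∧ q.2 < g i q.1} := by
      ext ω
      simp only [mem_ofPred_eq, mem_preimage, hf ω i, decide_eq_true_eq]
      rfl
    have h2 : P.map (fun ω => (res i (f ω), ω i)) = (ν.map (res i)).prod ρ := by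
      rw [(indepFun_iff_map_prod_eq_prod_map_map (hXm i).aemeasurable
        (measurable_pi_apply i).aemeasurable).1 (hind i), hi]
      congr 1
      exact Measure.infinitePi_map_eval _ i
    have h3 : {y : ι → Bool | res i y ∈ A ∧ y i = true} = res i ⁻¹' A ∩ {y | y i = true} := rfl
    rw [h1, ← Measure.map_apply ((hXm i).prodMk (measurable_pi_apply i)) hB, h2,
      Measure.prod_apply hB, h3, ← Measure.restrict_apply (hres i hA),
      ← Measure.map_apply (hres i) hA, ← Measure.setLIntegral_rnDeriv
        (Measure.absolutelyContinuous_of_le (hle i)), ← lintegral_indicator hA]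
    refine lintegral_congr_ae ?_
    filter_upwards [Measure.rnDeriv_le_one_of_le (hle i)] with x hx
    by_cases hxA : x ∈ A
    · rw [indicator_of_mem hxA]
      convert! hρ _ hx using 2
      ext u
      simp [hxA, g, ν₁]
    · rw [indicator_of_notMem hxA]
      simp [hxA]
  have hmax : ∀ i, P.map (fun ω => res i (f ω)) = ν.map (res i) →
      ∀ s : Finset ι, (∀ j ∈ s, j < i) →
        P {ω | ∀ j ∈ insert i s, f ω j = true} = ν {y | ∀ j ∈ insert i s, y j = true} := by
    intro i hi s hs
    convert! hstep i hi {x | ∀ j ∈ s.subtype (· ∈ Iio i), x j = true}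
      (measurableSet_forall_mem_eq (Finset.countable_toSet _) true) using 2
    all_goals
      ext y
      simp only [mem_ofPred_eq, Finset.forall_mem_insert, Finset.mem_subtype, Subtype.forall, res]
      exact ⟨fun h => ⟨fun j _ hj => h.2 j hj, h.1⟩, fun h => ⟨h.2, fun j hj => h.1 j (hs j hj) hj⟩⟩
  -- A finite set of indices below `i` is empty or has a largest element `j < i`, so the hypothesis
  -- at `j` suffices and limit stages need no separate argument.
  have hlaw : ∀ i, P.map (fun ω => res i (f ω)) = ν.map (res i) := by
    intro i
    induction i using WellFoundedLT.induction with
    | _ i ih =>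
      have := Measure.isProbabilityMeasure_map (μ := P) (hXm i).aemeasurable
      refine ext_of_finset_true fun s => ?_
      have hs : MeasurableSet {x : Iio i → Bool | ∀ j ∈ s, x j = true} :=
        measurableSet_forall_mem_eq (Finset.countable_toSet _) true
      rw [Measure.map_apply (hXm i) hs, Measure.map_apply (hres i) hs]
      induction s using Finset.induction_on_max with
      | empty => simp
      | insert j s hjs _ =>
        convert! hmax j (ih j j.2) (s.image (↑)) (by
          intro k hk
          obtain ⟨l, hl, rfl⟩ := Finset.mem_image.1 hk
          exact hjs l hl) using 2
        all_goals
          ext y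
          simp [res]
  refine ⟨f, hfm', ?_⟩
  have := Measure.isProbabilityMeasure_map (μ := P) hfm'.aemeasurable
  refine ext_of_finset_true fun s => ?_
  have hs : MeasurableSet {y : ι → Bool | ∀ j ∈ s, y j = true} :=
    measurableSet_forall_mem_eq (Finset.countable_toSet _) true
  rw [Measure.map_apply hfm' hs]
  induction s using Finset.induction_on_max with
  | empty => simp
  | insert j s hjs _ => exact hmax j (hlaw j) s hjs

end Sampling

/-! ### A uniform variable from fair coin tosses. -/

section Uniform

/-- The number with the given binary digits after the point. -/
noncomputable def binaryValue (y : ℕ → Bool) : ℝ :=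
  Real.ofDigits (b := 2) fun n => bif y n then 1 else 0

theorem binaryValue_nonneg (y : ℕ → Bool) : 0 ≤ binaryValue y := Real.ofDigits_nonneg _

theorem binaryValue_le_one (y : ℕ → Bool) : binaryValue y ≤ 1 := Real.ofDigits_le_one _

theorem measurable_binaryValue : Measurable binaryValue := by
  have h : Measurable fun (y : ℕ → Bool) (n : ℕ) => (bif y n then 1 else 0 : Fin 2) :=
    measurable_pi_iff.2 fun n =>
      (measurable_from_top (f := fun b : Bool => (bif b then 1 else 0 : Fin 2))).comp
        (measurable_pi_apply n)
  exact Real.continuous_ofDigits.measurable.comp h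

theorem binaryValue_eq (y : ℕ → Bool) :
    binaryValue y = ((bif y 0 then 1 else 0) + binaryValue fun n => y (n + 1)) / 2 := by
  unfold binaryValue
  rw [Real.ofDigits_eq_sum_add_ofDigits _ 1]
  cases h : y 0 <;> simp [Real.ofDigitsTerm, h] <;> ring

/-- The measure of a fair coin. -/
noncomputable abbrev coin : Measure Bool := (PMF.uniformOfFintype Bool).toMeasure

theorem coin_singleton (b : Bool) : coin {b} = 2⁻¹ := by
  rw [PMF.toMeasure_apply_singleton _ _ (measurableSet_singleton b)]
  simp

/-- The law of an infinite sequence of tosses of a fair coin. -/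
noncomputable abbrev coinSeq : Measure (ℕ → Bool) := Measure.infinitePi fun _ => coin

/-- Self-similarity: the first toss is independent of the remaining ones, which have the law of the
whole sequence. -/
theorem coinSeq_map_zero_succ :
    coinSeq.map (fun y => (y 0, fun n => y (n + 1))) = coin.prod coinSeq := by
  have hS : Measurable fun (y : ℕ → Bool) n => y (n + 1) := by fun_prop
  rw [(indepFun_iff_map_prod_eq_prod_map_map (measurable_pi_apply 0).aemeasurable
    hS.aemeasurable).1]
  · congr 1
    · exact Measure.infinitePi_map_eval _ 0
    · exact Measure.map_infinitePi_infinitePi_of_inj (P := fun _ : ℕ => coin)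
        (add_left_injective 1)
  · refine indepFun_infinitePi_of_disjoint (S := {0}) (T := Ici 1) coin (by simp) ?_ ?_
    · exact Measurable.mono (comap_measurable _) (le_iSup₂_of_le 0 rfl le_rfl) le_rfl
    · refine @measurable_pi_lambda _ _ _ (_) _ _ fun n => ?_
      exact Measurable.mono (comap_measurable _)
        (le_iSup₂_of_le (n + 1) (by simp) le_rfl) le_rfl

/-- Conditioning on the first toss gives a functional equation that determines the distribution
function. -/
theorem coinSeq_real_binaryValue_lt_eq (p : ℝ) :
    coinSeq.real {y | binaryValue y < p} = (coinSeq.real {y | binaryValue y < 2 * p} +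
      coinSeq.real {y | binaryValue y < 2 * p - 1}) / 2 := by
  have hB : MeasurableSet {q : Bool × (ℕ → Bool) |
      ((bif q.1 then 1 else 0) + binaryValue q.2) / 2 < p} := by
    refine measurableSet_lt (((Measurable.comp (g := fun b : Bool => (bif b then 1 else 0 : ℝ))
      measurable_from_top measurable_fst).add
        (measurable_binaryValue.comp measurable_snd)).div_const 2) measurable_const
  have h1 : {y | binaryValue y < p} = (fun y : ℕ → Bool => (y 0, fun n => y (n + 1))) ⁻¹'
      {q | ((bif q.1 then 1 else 0) + binaryValue q.2) / 2 < p} := by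
    ext y
    rw [mem_ofPred_eq, binaryValue_eq]
    rfl
  have h2 : coinSeq {y | binaryValue y < p} = coinSeq {y | binaryValue y < 2 * p - 1} * 2⁻¹ +
      coinSeq {y | binaryValue y < 2 * p} * 2⁻¹ := by
    rw [h1, ← Measure.map_apply (by fun_prop) hB, coinSeq_map_zero_succ, Measure.prod_apply hB,
      lintegral_fintype, Fintype.sum_bool, coin_singleton, coin_singleton]
    congr 3
    all_goals
      ext y
      simp only [mem_preimage, mem_ofPred_eq, cond_true, cond_false]
      constructor <;> intro h <;> linarith
  rw [measureReal_def, h2, ENNReal.toReal_add (by finiteness) (by finiteness), ENNReal.toReal_mul,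
    ENNReal.toReal_mul]
  simp only [measureReal_def, ENNReal.toReal_inv, ENNReal.toReal_ofNat]
  ring

/-- Under fair coin tosses the binary value is uniformly distributed on the unit interval. -/
theorem coinSeq_real_binaryValue_lt (p : ℝ) (h0 : 0 ≤ p) (h1 : p ≤ 1) :
    coinSeq.real {y | binaryValue y < p} = p := by
  let G (p : ℝ) : ℝ := coinSeq.real {y | binaryValue y < p}
  have hG0 : ∀ p ≤ 0, G p = 0 := by
    intro p hp
    have : {y | binaryValue y < p} = ∅ := by
      ext y
      simpa using hp.trans (binaryValue_nonneg y)
    simp [G, this]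
  have hG1 : ∀ p, 1 < p → G p = 1 := by
    intro p hp
    have : {y | binaryValue y < p} = Set.univ := by
      ext y
      simpa using (binaryValue_le_one y).trans_lt hp
    simp [G, this]
  have hG : ∀ p, G p = (G (2 * p) + G (2 * p - 1)) / 2 := coinSeq_real_binaryValue_lt_eq
  -- The clamp of `p` to the unit interval solves the same equation. On `(0, 1]` one of the two
  -- terms is known exactly, so each use of the equation halves the error bound.
  have key : ∀ (n : ℕ) (p : ℝ), |G p - max 0 (min 1 p)| ≤ (1 / 2) ^ n := by
    intro n
    induction n with
    | zero =>
      intro p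
      have h2 : 0 ≤ G p := measureReal_nonneg
      have h3 : G p ≤ 1 := measureReal_le_one
      have h4 : max 0 (min 1 p) ≤ 1 := max_le zero_le_one (min_le_left _ _)
      have h5 : 0 ≤ max 0 (min 1 p) := le_max_left _ _
      rw [pow_zero, abs_le]
      constructor <;> linarith
    | succ n ih =>
      intro p
      rw [pow_succ]
      rcases le_or_gt p 0 with hp | hp
      · rw [hG0 p hp, min_eq_right (by linarith), max_eq_left hp, sub_zero, abs_zero]
        positivity
      rcases lt_or_ge 1 p with hp' | hp'
      · rw [hG1 p hp', min_eq_left hp'.le, max_eq_right zero_le_one, sub_self, abs_zero]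
        positivity
      rw [min_eq_right hp', max_eq_right hp.le, hG p]
      rcases le_or_gt p (1 / 2) with hp2 | hp2
      · have := ih (2 * p)
        rw [min_eq_right (by linarith), max_eq_right (by linarith), abs_le] at this
        rw [hG0 (2 * p - 1) (by linarith), abs_le]
        constructor <;> linarith
      · have := ih (2 * p - 1)
        rw [min_eq_right (by linarith), max_eq_right (by linarith), abs_le] at this
        rw [hG1 (2 * p) (by linarith), abs_le]
        constructor <;> linarith
  have hlim : |G p - max 0 (min 1 p)| ≤ 0 :=
    ge_of_tendsto' (tendsto_pow_atTop_nhds_zero_of_lt_one (by norm_num) (by norm_num))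
      fun n => key n p
  rw [min_eq_right h1, max_eq_right h0] at hlim
  exact sub_eq_zero.1 (abs_nonpos_iff.1 hlim)

theorem coinSeq_map_Iio {p : ℝ≥0∞} (hp : p ≤ 1) :
    coinSeq.map (fun y => ENNReal.ofReal (binaryValue y)) (Iio p) = p := by
  have hp' : p ≠ ∞ := ne_top_of_le_ne_top ENNReal.one_ne_top hp
  rw [Measure.map_apply measurable_binaryValue.ennreal_ofReal measurableSet_Iio]
  have : (fun y => ENNReal.ofReal (binaryValue y)) ⁻¹' Iio p =
      {y | binaryValue y < p.toReal} := by
    ext y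
    exact ENNReal.ofReal_lt_iff_lt_toReal (binaryValue_nonneg y) hp'
  rw [this, ← ENNReal.toReal_eq_toReal_iff' (by finiteness) hp']
  exact coinSeq_real_binaryValue_lt _ ENNReal.toReal_nonneg
    (ENNReal.toReal_le_of_le_ofReal zero_le_one (by simpa using hp))

end Uniform

/-! ### Uncountable centered families from the covering number. -/

section Centered

variable {ι : Type} [LinearOrder ι] [WellFoundedLT ι]

/-- Since `ω₁ · ω = ω₁`, each index can be given its own sequence of coins, hence its own uniform
variable for the sampling. -/
theorem exists_measurePreserving_cubeMeasure (hι : #ι ≤ aleph.{0} 1) (ν : Measure (ι → Bool))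
    [IsProbabilityMeasure ν] :
    ∃ f : Cube (aleph.{0} 1) → ι → Bool, MeasurePreserving f (cubeMeasure (aleph 1)) ν := by
  have hcard : #(ι × ℕ) ≤ #(aleph.{0} 1).out := by
    rw [mk_out, mk_prod, lift_id, lift_id, mk_nat]
    exact (mul_le_mul' hι (aleph0_le_aleph 1)).trans_eq (mul_eq_self (aleph0_le_aleph 1))
  obtain ⟨e⟩ := hcard
  have hu : Measurable fun y => ENNReal.ofReal (binaryValue y) :=
    measurable_binaryValue.ennreal_ofReal
  let ρ : Measure ℝ≥0∞ := coinSeq.map fun y => ENNReal.ofReal (binaryValue y)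
  have : IsProbabilityMeasure ρ := Measure.isProbabilityMeasure_map hu.aemeasurable
  obtain ⟨f, hf⟩ := exists_measurePreserving_infinitePi ρ (fun p hp => coinSeq_map_Iio hp) ν
  have h1 : MeasurePreserving (fun (ω : Cube (aleph.{0} 1)) (q : ι × ℕ) => ω (e q))
      (cubeMeasure (aleph 1)) (Measure.infinitePi fun _ => coin) :=
    ⟨by fun_prop, Measure.map_infinitePi_infinitePi_of_inj (P := fun _ => coin) e.injective⟩
  have h2 : MeasurePreserving (MeasurableEquiv.curry ι ℕ Bool)
      (Measure.infinitePi fun _ => coin) (Measure.infinitePi fun _ => coinSeq) :=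
    ⟨MeasurableEquiv.measurable _, Measure.infinitePi_map_curry fun _ _ => coin⟩
  have h3 : MeasurePreserving (fun (ω : ι → ℕ → Bool) i => ENNReal.ofReal (binaryValue (ω i)))
      (Measure.infinitePi fun _ => coinSeq) (Measure.infinitePi fun _ => ρ) :=
    ⟨measurable_pi_iff.2 fun i => hu.comp (measurable_pi_apply i),
      Measure.infinitePi_map_pi (μ := fun _ : ι => coinSeq) fun _ => hu⟩
  exact ⟨_, hf.comp (h3.comp (h2.comp h1))⟩

/-- If `cov(𝒩_{ω₁}) > ω₁` then `ω₁` null sets do not cover a power of `Bool` with exponent of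
cardinality `ω₁`, for any probability measure. -/
theorem exists_forall_notMem_of_lt_cov (hcov : aleph.{0} 1 < cov (cubeNullIdeal (aleph.{0} 1)))
    (hι : #ι ≤ aleph.{0} 1) (ν : Measure (ι → Bool)) [IsProbabilityMeasure ν] {β : Type}
    (hβ : #β ≤ aleph.{0} 1) {N : β → Set (ι → Bool)} (hN : ∀ b, ν (N b) = 0) :
    ∃ y, ∀ b, y ∉ N b := by
  obtain ⟨f, hf⟩ := exists_measurePreserving_cubeMeasure hι ν
  by_contra! h
  refine hcov.not_ge (le_trans (csInf_le' ⟨range fun b => f ⁻¹' N b, ?_, ?_, rfl⟩)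
    (mk_range_le.trans hβ))
  · rintro _ ⟨b, rfl⟩
    exact hf.quasiMeasurePreserving.preimage_null (hN b)
  · refine eq_univ_of_forall fun ω => ?_
    obtain ⟨b, hb⟩ := h (f ω)
    exact ⟨_, ⟨b, rfl⟩, hb⟩

/-- A family of measurable sets is almost covered by the union of a countable subfamily. -/
theorem exists_countable_measure_diff_biUnion_eq_zero {X α : Type*} [MeasurableSpace X]
    (μ : Measure X) [IsFiniteMeasure μ] {A : α → Set X} (hA : ∀ i, MeasurableSet (A i))
    (T : Set α) : ∃ J ⊆ T, J.Countable ∧ ∀ i ∈ T, μ (A i \ ⋃ j ∈ J, A j) = 0 := by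
  -- The supremum of the measures of countable subunions is attained; adding one more set cannot
  -- increase it.
  let V : Set ℝ≥0∞ := (fun J : Set α => μ (⋃ j ∈ J, A j)) '' {J | J ⊆ T ∧ J.Countable}
  have hV : V.Nonempty := ⟨_, ∅, ⟨empty_subset _, countable_empty⟩, rfl⟩
  obtain ⟨v, -, hv, hvV⟩ := exists_seq_tendsto_sSup hV (OrderTop.bddAbove V)
  choose J hJ hJv using hvV
  have hJc : (⋃ n, J n).Countable := countable_iUnion fun n => (hJ n).2
  have hJT : ⋃ n, J n ⊆ T := iUnion_subset fun n => (hJ n).1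
  have hsup : sSup V ≤ μ (⋃ j ∈ ⋃ n, J n, A j) := le_of_tendsto' hv fun n =>
    (hJv n).symm.trans_le (measure_mono (biUnion_subset_biUnion_left (subset_iUnion J n)))
  refine ⟨⋃ n, J n, hJT, hJc, fun i hi => ?_⟩
  have hm : MeasurableSet (⋃ j ∈ ⋃ n, J n, A j) := MeasurableSet.biUnion hJc fun j _ => hA j
  have hle : μ (A i \ ⋃ j ∈ ⋃ n, J n, A j) + μ (⋃ j ∈ ⋃ n, J n, A j) ≤
      μ (⋃ j ∈ ⋃ n, J n, A j) := by
    rw [← measure_union disjoint_sdiff_left hm, sdiff_union_self, ← biUnion_insert]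
    have hmem : insert i (⋃ n, J n) ∈ {J | J ⊆ T ∧ J.Countable} :=
      ⟨insert_subset hi hJT, hJc.insert i⟩
    exact (le_sSup (mem_image_of_mem _ hmem)).trans hsup
  by_contra h0
  exact (ENNReal.lt_add_right (measure_ne_top μ _) h0).not_ge ((add_comm _ _).trans_le hle)

/-- If `cov(𝒩_{ω₁}) > ω₁` then among `ω₁` sets of positive measure there are uncountably many that
form a centered family. -/
theorem exists_uncountable_centered (hcov : aleph.{0} 1 < cov (cubeNullIdeal (aleph.{0} 1)))
    (hcard : #ι = aleph.{0} 1) (hι : ∀ i : ι, (Iio i).Countable) {X : Type*} [MeasurableSpace X]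
    (μ : Measure X) [IsFiniteMeasure μ] {F : ι → Set X} (hF : ∀ i, MeasurableSet (F i))
    (hpos : ∀ i, μ (F i) ≠ 0) :
    ∃ S : Set ι, ¬ S.Countable ∧ ∀ s : Finset ι, ↑s ⊆ S → (⋂ i ∈ s, F i).Nonempty := by
  classical
  have hunc : ¬ (univ : Set ι).Countable := by
    rw [countable_univ_iff, ← mk_le_aleph0_iff, hcard, not_le]
    exact aleph0_lt_aleph_one
  choose J hJsub hJc hJ using fun i =>
    exists_countable_measure_diff_biUnion_eq_zero μ hF (Ici i)
  let G (i : ι) : Set X := ⋃ j ∈ J i, F j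
  have hG : ∀ i, MeasurableSet (G i) := fun i => MeasurableSet.biUnion (hJc i) fun j _ => hF j
  have hanti : ∀ i j, i ≤ j → μ (G j \ G i) = 0 := by
    intro i j hij
    simp only [G, iUnion_sdiff]
    exact (measure_biUnion_null_iff (hJc j)).2 fun k hk => hJ i k (hij.trans (hJsub j hk))
  -- The tail unions `G i` decrease modulo null sets. Exhausting their complements by countably many
  -- shows that they are constant modulo null sets from some `a` on.
  obtain ⟨C, -, hC, hCG⟩ :=
    exists_countable_measure_diff_biUnion_eq_zero μ (fun i => (hG i).compl) univ
  obtain ⟨a, -, ha⟩ := exists_mem_forall_lt hι hunc hC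
  have hstab : ∀ i, μ (G a \ G i) = 0 := by
    intro i
    refine measure_mono_null (t := ((G i)ᶜ \ ⋃ j ∈ C, (G j)ᶜ) ∪ ⋃ j ∈ C, G a \ G j) ?_
      (measure_union_null (hCG i trivial)
        ((measure_biUnion_null_iff hC).2 fun c hc => hanti c a (ha c hc).le))
    intro x hx
    by_cases h : x ∈ ⋃ j ∈ C, (G j)ᶜ
    · right
      simp only [mem_iUnion] at h ⊢
      obtain ⟨j, hj, hxj⟩ := h
      exact ⟨j, hj, hx.1, hxj⟩
    · exact Or.inl ⟨hx.2, h⟩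
  have hGa : μ (G a) ≠ 0 := by
    intro h
    refine hpos a (measure_mono_null (t := (F a \ G a) ∪ G a) (by simp)
      (measure_union_null (hJ a a le_rfl) h))
  have := cond_isProbabilityMeasure hGa
  let φ (x : X) (i : ι) : Bool := decide (x ∈ F i)
  have hφ : Measurable φ := measurable_pi_iff.2 fun i => by
    refine measurable_to_bool ?_
    convert! hF i using 1
    ext; simp [φ]
  have := Measure.isProbabilityMeasure_map (μ := μ[|G a]) hφ.aemeasurable
  -- Avoiding the first kind makes `y` true somewhere at or beyond each `i`; it is null since almost
  -- all of `G a` lies in `G i`. Avoiding the second kind makes the chosen sets centered; its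
  -- preimage is empty.
  let N : ι ⊕ {s : Finset ι // ⋂ i ∈ s, F i = ∅} → Set (ι → Bool) := Sum.elim
    (fun i => {y | ∀ j ∈ J i, y j = false}) fun s => {y | ∀ i ∈ s.1, y i = true}
  obtain ⟨y, hy⟩ := exists_forall_notMem_of_lt_cov hcov hcard.le (μ[|G a].map φ) (N := N)
    (by
      have : Infinite ι := by
        rw [infinite_iff, hcard]; exact aleph0_le_aleph 1
      rw [mk_sum, lift_id, lift_id, hcard]
      refine (add_le_add_right ((mk_subtype_le _).trans_eq
        ((mk_finset_of_infinite ι).trans hcard)) _).trans_eq (add_eq_self (aleph0_le_aleph 1)))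
    (by
      rintro (i | ⟨s, hs⟩)
      · have hm := measurableSet_forall_mem_eq (hJc i) false
        have hpre : φ ⁻¹' {y : ι → Bool | ∀ j ∈ J i, y j = false} = (G i)ᶜ := by
          ext x
          simp [φ, G]
        dsimp only [N, Sum.elim_inl]
        rw [Measure.map_apply hφ hm, hpre, cond_apply (hG a), ← sdiff_eq, hstab, mul_zero]
      · have hm : MeasurableSet {y : ι → Bool | ∀ i ∈ s, y i = true} :=
          measurableSet_forall_mem_eq (Finset.countable_toSet _) true
        have hpre : φ ⁻¹' {y : ι → Bool | ∀ i ∈ s, y i = true} = ⋂ i ∈ s, F i := by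
          ext x
          simp [φ]
        dsimp only [N, Sum.elim_inr]
        rw [Measure.map_apply hφ hm, hpre, hs, measure_empty])
  refine ⟨{i | y i = true}, fun hS => ?_, fun s hs => ?_⟩
  · obtain ⟨i, -, hi⟩ := exists_mem_forall_lt hι hunc hS
    have := hy (Sum.inl i)
    simp only [N, Sum.elim_inl, mem_ofPred_eq, not_forall, Bool.not_eq_false] at this
    obtain ⟨j, hj, hyj⟩ := this
    exact (hi j hyj).not_ge (hJsub i hj)
  · by_contra h
    exact hy (Sum.inr ⟨s, not_nonempty_iff_eq_empty.1 h⟩) fun i hi => hs hi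

end Centered

end SmallCompacta

theorem corollary4p5
    (hcov : Cardinal.aleph.{0} 1 < SmallCompacta.cov (SmallCompacta.cubeNullIdeal (Cardinal.aleph.{0} 1)))
    (K : Type u) [TopologicalSpace K] [CompactSpace K] [T2Space K]
    [MeasurableSpace K] [BorelSpace K]
    (hK : SmallCompacta.CountablyTight K) (hμ : SmallCompacta.SupportsMeasure K) :
    ∃ P : Set (Set K), P.Countable ∧ SmallCompacta.IsPiBase P := by
  obtain ⟨μ, hfin, -, hpos⟩ := hμ
  have hι : ∀ i : (aleph.{0} 1).ord.ToType, (Set.Iio i).Countable := fun i => by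
    rw [← Cardinal.le_aleph0_iff_set_countable, ← Order.lt_succ_iff, succ_aleph0]
    exact (mk_Iio_lt i (by simp)).trans_eq (mk_ord_toType _)
  refine hK.exists_countable_piBase hι fun F hF hFi =>
    SmallCompacta.exists_uncountable_centered hcov (mk_ord_toType _) hι μ
      (fun i => (hF i).measurableSet) fun i => ?_
  exact ((hpos _ isOpen_interior (hFi i)).trans_le (measure_mono interior_subset)).ne'
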